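/- **Setting.** Let $\lambda$ be the security parameter and let $h=h(\lambda)\ge 1$ with $h\in\mathsf{poly}(\lambda)$. Let $T(h)$ be the perfect binary tree of height $h$ with nodes $1,\dots,2^{h+1}-1$ (root $1$, parent of $v$ is $\lfloor v/2\rfloor$), and let $N=2^{h+1}-2$ be its number of nodes other than the root. A coloring of the non-root nodes with $h$ colors, with color classes $C_1,\dots,C_h$, is *ancestral* if no two distinct nodes of the same color are ancestor and descendant, and *balanced* if $\bigl||C_i|-|C_j|\bigr|\le 1$ for all $i,j$. Fix any listing of each class. The swapped Merkle tree carries at each node the content of the sibling of this node, so that the Merkle proof for leaf $j$ is the content of the path from the root (excluded) to $j$; server $i$ stores the contents of the nodes in $C_i$ as a sub-database. For an ancestral coloring every such path has exactly one node of each color. *Parallel retrieval* for the leaf $j$: for every $i$, with independent randomness, the client sends to server $i$ one query of an underlying single-server PIR scheme for the position, in the $i$-th sub-database, of the path node of color $i$. "Probabilistic polynomial time (PPT)" is meant non-uniformly: a randomized Boolean circuit for each $\lambda$, of size polynomial in $\lambda$. Assume that on databases with at most $N(\lambda)$ items query generation of the PIR scheme is PPT (in $\lambda$), and that the scheme is computationally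 private there: for all sizes $n(\lambda)\le N(\lambda)$, all indices $k(\lambda),k'(\lambda)\in[n(\lambda)]$ and every PPT distinguisher $\mathfrak A$, the advantage $\bigl|\Pr[\mathfrak A(q(k))=1]-\Pr[\mathfrak A(q(k'))=1]\bigr|$ is negligible in $\lambda$. The server is a deterministic (multi-stack Turing) machine; its time on databases of $d$ items is its number of steps, in the worst case over the databases, the requested indices and the client's coins. Let $\mathsf C(d)=\mathsf C_\lambda(d)$ be non-decreasing in $d$ and bound this time for every $d$. The *parallel server time* is the maximum, over the $h$ servers, of the number of steps made by a server, in the worst case over the contents of the tree nodes, the leaves and the client's coins. **Theorem.** 1. (Privacy.) Let an ancestral coloring of $T(h(\lambda))$ with $h(\lambda)$ colors be given for every $\lambda$. For all leaves $j(\lambda),j'(\lambda)$ and every PPT distinguisher $\mathfrak A$ that sees all $h$ queries, the advantage of $\mathfrak A$ in distinguishing the batch request for $j$ from the batch request for $j'$ is negligible. More precisely, there are distinguishers $\mathfrak A_1,\dots,\mathfrak A_{h}$, of size bounded by a common polynomial in $\lambda$, such that for every $\lambda$ this advantage is at most $\sum_{i=1}^{h}\varepsilon_i(\lambda)$, where $\varepsilon_i(\lambda)$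 is the advantage of $\mathfrak A_i$ in distinguishing the single PIR queries for the two positions requested from server $i$. For every choice of $i=i(\lambda)\in[h(\lambda)]$ the term $\varepsilon_{i(\lambda)}(\lambda)$ is negligible in $\lambda$, and so is the sum of all $h$ terms. 2. (Sizes.) For every balanced ancestral coloring of $T(h)$ with $h$ colors, each of the $h$ sub-databases has $\lfloor N/h\rfloor$ or $\lceil N/h\rceil$ items. 3. (Server time.) For every balanced ancestral coloring of $T(h)$ with $h$ colors, the parallel server time is at most $\mathsf C(\lceil N/h\rceil)$. It is equal to $\mathsf C(\lceil N/h\rceil)$ if $\mathsf C(\lceil N/h\rceil)$ is the exact worst-case time of the server on databases of $\lceil N/h\rceil$ items. -/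

import Mathlib

/-! # Parallel private retrieval of Merkle proofs by ancestral colorings

The security parameter is written `κ` throughout. -/

namespace MerklePIR

/-! ## Asymptotics and probabilities -/

/-- `f ∈ poly(κ)`. -/
def PolyBounded (f : ℕ → ℕ) : Prop :=
  ∃ p : Polynomial ℕ, ∀ κ, f κ ≤ p.eval κ

/-- `ε ∈ negl(κ)`. -/
def Negligible (ε : ℕ → ℝ) : Prop :=
  ∀ c : ℕ, 0 < c → ∃ κ₀ : ℕ, ∀ κ > κ₀, ε κ < 1 / (κ : ℝ) ^ c

/-- Probability that `f ω = true` when `ω` is uniform in the finite set `Ω`. -/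
noncomputable def uniformProb {Ω : Type} [Fintype Ω] (f : Ω → Bool) : ℝ :=
  ((Finset.univ.filter fun ω => f ω = true).card : ℝ) / (Fintype.card Ω : ℝ)

/-! ## Non-uniform computation: straight-line NAND programs (Boolean circuits) -/

/-- The instruction `reg[dst] := NAND (reg[src₁], reg[src₂])`, i.e. one gate. -/
structure NandInstr where
  dst : ℕ
  src₁ : ℕ
  src₂ : ℕ

/-- Executes one instruction. -/
def NandInstr.exec (s : ℕ → Bool) (g : NandInstr) : ℕ → Bool :=
  Function.update s g.dst (!(s g.src₁ && s g.src₂))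

/-- Runs a sequence of instructions. The input occupies the registers `0, …, length - 1`; every
other register initially holds `false`. -/
def runNand (code : List NandInstr) (input : List Bool) : ℕ → Bool :=
  code.foldl NandInstr.exec fun k => input.getD k false

/-- A Boolean circuit with several outputs: its gates and its list of output registers. -/
structure NandProgram where
  code : List NandInstr
  out : List ℕ

/-- The output bits of a program. -/
def NandProgram.eval (P : NandProgram) (input : List Bool) : List Bool :=
  P.out.map (runNand P.code input)

/-- Number of gates plus number of outputs. -/
def NandProgram.size (P : NandProgram) : ℕ := P.code.length + P.out.length

/-- One member (for one value of `κ`) of a probabilistic distinguishing algorithm: a circuit with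
one output bit that reads the string to be judged followed by `coins` uniform random bits. All
public parameters (`κ`, database sizes, tree height) are fixed with `κ`, so they may be built into
the circuit. -/
structure Distinguisher where
  code : List NandInstr
  out : ℕ
  coins : ℕ

/-- The output bit on the string `q` and the random bits `s`. -/
def Distinguisher.accepts (A : Distinguisher) (q : List Bool) (s : Fin A.coins → Bool) : Bool :=
  runNand A.code (q ++ List.ofFn s) A.out

/-- Number of gates plus number of random bits. -/
def Distinguisher.size (A : Distinguisher) : ℕ := A.code.length + A.coins

/-- A (non-uniform) probabilistic polynomial time algorithm: a circuit for each `κ`, of size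
polynomial in `κ`. -/
def IsPPT (A : ℕ → Distinguisher) : Prop := PolyBounded fun κ => (A κ).size

/-- Distinguishing advantage of `A` between the distributions of `f ω` and `g ω`, `ω ∈ Ω` uniform:
`|Pr[A(f ω) = 1] - Pr[A(g ω) = 1]|`. -/
noncomputable def advantage {Ω : Type} [Fintype Ω] (A : Distinguisher) (f g : Ω → List Bool) : ℝ :=
  |uniformProb (fun t : Ω × (Fin A.coins → Bool) => A.accepts (f t.1) t.2) -
    uniformProb (fun t : Ω × (Fin A.coins → Bool) => A.accepts (g t.1) t.2)|

/-! ## Private information retrieval -/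

/-- Database items for security parameter `κ`: strings of `itemLen κ` bits (hash values). -/
abbrev Item (itemLen : ℕ → ℕ) (κ : ℕ) : Type := Fin (itemLen κ) → Bool

/-- Input of the server: `1^κ`, the items of the database and the query, each part terminated or
preceded by the separator `none`. -/
def serverInput {itemLen : ℕ → ℕ} (κ n : ℕ) (x : Fin n → Item itemLen κ) (q : List Bool) :
    List (Option Bool) :=
  List.replicate κ (some true) ++ [none] ++
    (List.ofFn fun k => (List.ofFn (x k)).map some ++ [none]).flatten ++ q.map some

/-- A single-server PIR scheme. The randomized query generation is a function of the index and of
uniformly random coins; the client keeps the coins for the reconstruction. The server is a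
deterministic (multi-stack) Turing machine. -/
structure PIRScheme (itemLen : ℕ → ℕ) where
  /-- number of random bits of the query generation, for `κ` and database size `n` -/
  coins : ℕ → ℕ → ℕ
  /-- bit length of a query, for `κ` and database size `n` -/
  queryLen : ℕ → ℕ → ℕ
  /-- query generation `q ← Q(n, 1^κ, {j})` -/
  query : ∀ κ n : ℕ, Fin n → (Fin (coins κ n) → Bool) → (Fin (queryLen κ n) → Bool)
  /-- the machine run by the server -/
  server : Turing.TM2ComputableAux (Option Bool) (Option Bool)
  /-- the answer `a ← A(x, 1^κ, q)` -/
  answer : ∀ κ n : ℕ, (Fin n → Item itemLen κ) → (Fin (queryLen κ n) → Bool) → List (Option Bool)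
  /-- the run of the server that outputs this answer -/
  answerRun : ∀ (κ n : ℕ) (x : Fin n → Item itemLen κ) (q : Fin (queryLen κ n) → Bool),
    Turing.TM2Outputs server.tm
      ((serverInput κ n x (List.ofFn q)).map server.inputAlphabet.symm)
      (some ((answer κ n x q).map server.outputAlphabet.symm))
  /-- reconstruction by the client -/
  reconstruct : ∀ κ n : ℕ, Fin n → (Fin (coins κ n) → Bool) → List (Option Bool) → Item itemLen κ
  /-- the client always retrieves the desired item -/
  correct : ∀ (κ n : ℕ) (x : Fin n → Item itemLen κ) (j : Fin n) (r : Fin (coins κ n) → Bool),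
    reconstruct κ n j r (answer κ n x (query κ n j r)) = x j

/-- Binary representation of an index into a database of size `n`. -/
def indexBits (n : ℕ) (j : Fin n) : List Bool :=
  List.ofFn fun k : Fin (Nat.size n) => (j : ℕ).testBit k

namespace PIRScheme

variable {itemLen : ℕ → ℕ} (S : PIRScheme itemLen)

/-- Query generation takes (non-uniform) probabilistic polynomial time on databases of size at most
`D κ`: it uses at most `p(κ)` random bits and is computed from the index and these bits by a
circuit of size at most `p(κ)`, for some polynomial `p`. -/
def PPTQuery (D : ℕ → ℕ) : Prop :=
  ∃ p : Polynomial ℕ, ∀ κ n, n ≤ D κ →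
    S.coins κ n ≤ p.eval κ ∧
    ∃ P : NandProgram, P.size ≤ p.eval κ ∧
      ∀ (j : Fin n) (r : Fin (S.coins κ n) → Bool),
        P.eval (indexBits n j ++ List.ofFn r) = List.ofFn (S.query κ n j r)

/-- Advantage of `A` in distinguishing a query for the index `j` from a query for `j'`. -/
noncomputable def queryAdvantage (κ n : ℕ) (j j' : Fin n) (A : Distinguisher) : ℝ :=
  advantage A (fun r => List.ofFn (S.query κ n j r)) (fun r => List.ofFn (S.query κ n j' r))

/-- Computational privacy on databases of size at most `D κ`. -/
def Private (D : ℕ → ℕ) : Prop :=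
  ∀ n : ℕ → ℕ, (∀ κ, n κ ≤ D κ) → ∀ j j' : (∀ κ, Fin (n κ)),
    ∀ A : ℕ → Distinguisher, IsPPT A →
      Negligible fun κ => S.queryAdvantage κ (n κ) (j κ) (j' κ) (A κ)

/-- Number of steps that the server makes on the database `x` when the client asks for the index
`j` with coins `r`. -/
def serverSteps (κ n : ℕ) (x : Fin n → Item itemLen κ) (j : Fin n)
    (r : Fin (S.coins κ n) → Bool) : ℕ :=
  (S.answerRun κ n x (S.query κ n j r)).steps

/-- Server time on databases of size `n`: the worst case over databases, indices and coins. -/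
def serverTime (κ n : ℕ) : ℕ :=
  Finset.univ.sup fun t : (Fin n → Item itemLen κ) × Fin n × (Fin (S.coins κ n) → Bool) =>
    S.serverSteps κ n t.1 t.2.1 t.2.2

end PIRScheme

/-! ## Perfect binary trees and ancestral colorings -/

/-- Number of nodes, without the root, of the perfect binary tree of height `h`. -/
def treeSize (h : ℕ) : ℕ := 2 ^ (h + 1) - 2

/-- Nodes other than the root of the perfect binary tree `T(h)`. Nodes are numbered
`1, …, 2^(h+1) - 1` from top to bottom and left to right; `1` is the root and the parent of `v`
is `⌊v/2⌋`. -/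
abbrev Node (h : ℕ) : Type := {v : ℕ // v ∈ Finset.Ico 2 (2 ^ (h + 1))}

/-- Leaves of `T(h)`. -/
abbrev Leaf (h : ℕ) : Type := {v : ℕ // v ∈ Finset.Ico (2 ^ h) (2 ^ (h + 1))}

/-- `u` lies on the path from `v` to the root. -/
def IsAncestor {h : ℕ} (u v : Node h) : Prop := ∃ k : ℕ, (u : ℕ) = (v : ℕ) / 2 ^ k

/-- The Ancestral Property: a node and a proper ancestor of it never have the same color. -/
def IsAncestral {h : ℕ} (color : Node h → Fin h) : Prop :=
  ∀ u v : Node h, u ≠ v → IsAncestor u v → color u ≠ color v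

/-- The nodes of color `i`. -/
abbrev ColorClass {h : ℕ} (color : Node h → Fin h) (i : Fin h) : Type := {v : Node h // color v = i}

/-- Number of nodes of color `i`. -/
abbrev classSize {h : ℕ} (color : Node h → Fin h) (i : Fin h) : ℕ :=
  Fintype.card (ColorClass color i)

/-- The Balanced Property: sizes of any two color classes differ by at most one. -/
def IsBalanced {h : ℕ} (color : Node h → Fin h) : Prop :=
  ∀ i j, classSize color i ≤ classSize color j + 1

/-- The sibling of a node. -/
def sibling {h : ℕ} (v : Node h) : Node h :=
  ⟨if (v : ℕ) % 2 = 0 then v + 1 else v - 1, by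
    have hv := Finset.mem_Ico.1 v.2
    have hp : 2 ^ (h + 1) = 2 * 2 ^ h := by ring
    rw [Finset.mem_Ico]
    split <;> omega⟩

/-- The node `⌊j / 2^k⌋` of the path from the root to the leaf `j`; `k < h` excludes the root. -/
def pathNode {h : ℕ} (j : Leaf h) (k : Fin h) : Node h :=
  ⟨(j : ℕ) / 2 ^ (k : ℕ), by
    obtain ⟨j, hj⟩ := j
    obtain ⟨k, hk⟩ := k
    rw [Finset.mem_Ico] at hj ⊢
    constructor
    · rw [Nat.le_div_iff_mul_le (by positivity)]
      calc 2 * 2 ^ k = 2 ^ (k + 1) := by ring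
        _ ≤ 2 ^ h := Nat.pow_le_pow_right (by norm_num) hk
        _ ≤ j := hj.1
    · exact lt_of_le_of_lt (Nat.div_le_self _ _) hj.2⟩

theorem pathNode_color_injective {h : ℕ} {color : Node h → Fin h} (hc : IsAncestral color)
    (j : Leaf h) : Function.Injective fun k => color (pathNode j k) := by
  have key : ∀ k l : Fin h, k < l → color (pathNode j k) ≠ color (pathNode j l) := by
    intro k l hkl
    have hkl' : (k : ℕ) < l := hkl
    have hdiv : (pathNode j l : ℕ) = (pathNode j k : ℕ) / 2 ^ ((l : ℕ) - k) := by
      simp only [pathNode]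
      rw [Nat.div_div_eq_div_mul, ← pow_add]
      congr 2
      omega
    refine (hc _ _ ?_ ⟨_, hdiv⟩).symm
    intro he
    have h2 : 2 ≤ (pathNode j k : ℕ) := (Finset.mem_Ico.1 (pathNode j k).2).1
    have hlt : (pathNode j k : ℕ) / 2 ^ ((l : ℕ) - k) < (pathNode j k : ℕ) :=
      Nat.div_lt_self (by omega) (Nat.one_lt_pow (by omega) (by norm_num))
    rw [← hdiv, he] at hlt
    exact lt_irrefl _ hlt
  intro k l hkl
  rcases lt_trichotomy k l with hlt | heq | hgt
  · exact absurd hkl (key k l hlt)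
  · exact heq
  · exact absurd hkl.symm (key l k hgt)

/-- Every root-to-leaf path contains a node of each of the `h` colors. -/
theorem exists_pathNode_color {h : ℕ} {color : Node h → Fin h} (hc : IsAncestral color)
    (j : Leaf h) (i : Fin h) : ∃ k, color (pathNode j k) = i :=
  Finite.surjective_of_injective (pathNode_color_injective hc j) i

/-- Partition of `T(h)` into `h` sub-databases: an ancestral coloring together with an order in
which each color class is listed. -/
structure AncestralPartition (h : ℕ) where
  color : Node h → Fin h
  ancestral : IsAncestral color
  enum : ∀ i, ColorClass color i ≃ Fin (classSize color i)

namespace AncestralPartition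

variable {h : ℕ} (P : AncestralPartition h)

/-- Size of the `i`-th sub-database. -/
abbrev size (i : Fin h) : ℕ := classSize P.color i

/-- The (only) node of color `i` of the path from the root to the leaf `j`. -/
noncomputable def coloredNode (j : Leaf h) (i : Fin h) : ColorClass P.color i :=
  ⟨pathNode j (exists_pathNode_color P.ancestral j i).choose,
    (exists_pathNode_color P.ancestral j i).choose_spec⟩

/-- Index, within the `i`-th sub-database, of the node of color `i` of the path to the leaf `j`. -/
noncomputable def subIndex (j : Leaf h) (i : Fin h) : Fin (P.size i) :=
  P.enum i (P.coloredNode j i)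

/-- The `i`-th sub-database, if the Merkle tree has content `x v` at the node `v`. The coloring
refers to the swapped Merkle tree, which has content `x (sibling v)` at `v`; so the nodes of the
path from the root to the leaf `j` carry the Merkle proof of the item at the leaf `j`. -/
def subDatabase {α : Type} (x : Node h → α) (i : Fin h) : Fin (P.size i) → α :=
  fun k => x (sibling ((P.enum i).symm k : ColorClass P.color i).1)

end AncestralPartition

/-! ## Coloring-based parallel private retrieval of Merkle proofs -/

section Parallel

variable {itemLen : ℕ → ℕ} (S : PIRScheme itemLen) (κ : ℕ) {h : ℕ} (P : AncestralPartition h)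

/-- Coins of the client: independent coins for each of the `h` servers. -/
abbrev BatchCoins : Type := ∀ i : Fin h, Fin (S.coins κ (P.size i)) → Bool

/-- The batch of all `h` queries, for the Merkle proof given by the leaf `j`: server `i` receives
one query of the underlying scheme, for the node of color `i`. -/
noncomputable def batchQuery (j : Leaf h) (r : BatchCoins S κ P) : List Bool :=
  (List.ofFn fun i => List.ofFn (S.query κ (P.size i) (P.subIndex j i) (r i))).flatten

/-- Advantage of `A`, which sees all `h` queries, in distinguishing the batch request for the leaf
`j` from the one for `j'`. -/
noncomputable def batchAdvantage (j j' : Leaf h) (A : Distinguisher) : ℝ :=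
  advantage A (batchQuery S κ P j) (batchQuery S κ P j')

/-- Parallel server time of one execution: the largest number of steps made by one server. -/
noncomputable def parallelSteps (x : Node h → Item itemLen κ) (j : Leaf h)
    (r : BatchCoins S κ P) : ℕ :=
  Finset.univ.sup fun i : Fin h =>
    S.serverSteps κ (P.size i) (P.subDatabase x i) (P.subIndex j i) (r i)

/-- Parallel server time: the worst case over tree contents, leaves and coins. -/
noncomputable def parallelServerTime : ℕ :=
  Finset.univ.sup fun t : (Node h → Item itemLen κ) × Leaf h × BatchCoins S κ P =>
    parallelSteps S κ P t.1 t.2.1 t.2.2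

end Parallel

/-- Computational privacy of the batch retrieval with partitions `P κ` of the trees `T(h κ)`. -/
def BatchPrivate {itemLen : ℕ → ℕ} (S : PIRScheme itemLen) {h : ℕ → ℕ}
    (P : ∀ κ, AncestralPartition (h κ)) : Prop :=
  ∀ j j' : (∀ κ, Leaf (h κ)), ∀ A : ℕ → Distinguisher, IsPPT A →
    Negligible fun κ => batchAdvantage S κ (P κ) (j κ) (j' κ) (A κ)

end MerklePIR

/-!
Privacy is a hybrid argument over the `h` servers. The `k`-th hybrid batch takes the queries for
`j'` for the first `k` servers and the queries for `j` for the others, so consecutive hybrids differ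
in the query to one server, and the triangle inequality bounds the batch advantage by the sum of the
`h` consecutive differences. Each difference is an average, over the coins of the other queries and
those of the distinguisher, of differences of probabilities over the coins of the one changed query.
As distinguishers are non-uniform, coins that do at least as well as the average can be fixed and
wired into the circuit: this gives a circuit that reads a single query, does not have to generate any
other query, and is larger by at most the total length of the fixed strings
(`exists_hybrid_step`). The number of output gates of the query generator bounds the length of a
query, so these sizes are bounded by one polynomial. A sum of `h` terms is at most `h` times its
largest term, which is negligible by privacy of the scheme at the index of this term
(`Negligible.sum`).

For the sizes, classes whose sizes differ by at most one and add up to `N` have size `⌊N / h⌋` or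
`⌈N / h⌉`, and the largest class has size `⌈N / h⌉`. The time bound follows by monotonicity. Equality
holds because every index and every content of the largest sub-database occur in the parallel
retrieval: every node lies on the path to some leaf, on which it is the only node of its color, and
swapping siblings permutes the nodes (`serverTime_le_parallelServerTime`).
-/

namespace MerklePIR

/-! ### Hardwiring inputs into circuits -/

/-- The gate `g` with its registers renamed by `σ`. -/
def NandInstr.rename (σ : ℕ → ℕ) (g : NandInstr) : NandInstr :=
  ⟨σ g.dst, σ g.src₁, σ g.src₂⟩

/-- A renamed gate acts on the renamed registers as the original gate does on the original ones. -/
theorem NandInstr.exec_rename_comp {σ : ℕ → ℕ} (hσ : Function.Injective σ) (s : ℕ → Bool)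
    (g : NandInstr) : (g.rename σ).exec s ∘ σ = g.exec (s ∘ σ) :=
  Function.update_comp_eq_of_injective s hσ g.dst _

theorem foldl_exec_rename_comp {σ : ℕ → ℕ} (hσ : Function.Injective σ) (code : List NandInstr)
    (s : ℕ → Bool) :
    (code.map (NandInstr.rename σ)).foldl NandInstr.exec s ∘ σ =
      code.foldl NandInstr.exec (s ∘ σ) := by
  induction code generalizing s with
  | nil => rfl
  | cons g code ih =>
    rw [List.map_cons, List.foldl_cons, List.foldl_cons, ih, NandInstr.exec_rename_comp hσ]

/-- Gates that write the constant string `c` into the registers `n, …, n + c.length - 1`. An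
untouched register `n` holds `false`, so the gate `reg[n] := NAND (reg[n], reg[n])` makes it
`true`, and no gate is needed for a bit `false`. -/
def constGates : ℕ → List Bool → List NandInstr
  | _, [] => []
  | n, b :: c => (if b then [⟨n, n, n⟩] else []) ++ constGates (n + 1) c

theorem length_constGates_le (n : ℕ) (c : List Bool) : (constGates n c).length ≤ c.length := by
  induction c generalizing n with
  | nil => simp [constGates]
  | cons b c ih =>
    have := ih (n + 1)
    cases b <;> simp [constGates] <;> omega

theorem foldl_exec_constGates (q c : List Bool) :
    (constGates q.length c).foldl NandInstr.exec (fun k => q.getD k false) =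
      fun k => (q ++ c).getD k false := by
  induction c generalizing q with
  | nil => simp [constGates]
  | cons b c ih =>
    have hstep : (if b then [(⟨q.length, q.length, q.length⟩ : NandInstr)] else []).foldl
        NandInstr.exec (fun k => q.getD k false) = fun k => (q ++ [b]).getD k false := by
      funext k
      rcases lt_trichotomy k q.length with hk | hk | hk
      · cases b <;> simp [NandInstr.exec, Function.update, List.getElem?_append_left hk, hk.ne]
      · subst hk
        cases b <;> simp [NandInstr.exec]
      · have hk' : k - q.length ≠ 0 := by omega
        cases b <;>
          simp [NandInstr.exec, Function.update, hk.ne', List.getElem?_append_right hk.le, hk.le,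
            hk']
    have hlen : q.length + 1 = (q ++ [b]).length := by simp
    rw [constGates, List.foldl_append, hstep, hlen, ih]
    simp

/-- The permutation of positions that takes a string `pre ++ q ++ suf` with `pre.length = a` and
`q.length = n` to `q ++ (pre ++ suf)`. -/
def moveToFront (a n m : ℕ) : ℕ :=
  if m < a then m + n else if m < a + n then m - a else m

theorem moveToFront_injective (a n : ℕ) : Function.Injective (moveToFront a n) := by
  intro x y hxy
  unfold moveToFront at hxy
  split_ifs at hxy <;> omega

theorem getD_moveToFront (pre q suf : List Bool) (m : ℕ) :
    (q ++ (pre ++ suf)).getD (moveToFront pre.length q.length m) false =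
      (pre ++ q ++ suf).getD m false := by
  simp only [List.getD_eq_getElem?_getD, List.getElem?_append, List.length_append, moveToFront]
  split_ifs <;> first | omega | (congr 2; omega) | simp_all

/-- The distinguisher `A` with the constants `pre` and `suf` wired in around an input of `n` bits;
the random bits of `A` belong to the constant `suf`. -/
def Distinguisher.hardwire (A : Distinguisher) (pre suf : List Bool) (n : ℕ) : Distinguisher where
  code := constGates n (pre ++ suf) ++ A.code.map (NandInstr.rename (moveToFront pre.length n))
  out := moveToFront pre.length n A.out
  coins := 0

theorem Distinguisher.size_hardwire_le (A : Distinguisher) (pre suf : List Bool) (n : ℕ) :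
    (A.hardwire pre suf n).size ≤ A.code.length + (pre.length + suf.length) := by
  have := length_constGates_le n (pre ++ suf)
  simp only [List.length_append] at this
  simp only [Distinguisher.size, Distinguisher.hardwire, List.length_append, List.length_map]
  omega

theorem Distinguisher.hardwire_accepts (A : Distinguisher) (pre suf q : List Bool)
    (s : Fin A.coins → Bool) (t : Fin 0 → Bool) :
    (A.hardwire pre (suf ++ List.ofFn s) q.length).accepts q t =
      A.accepts (pre ++ q ++ suf) s := by
  have h := congrFun (foldl_exec_rename_comp (moveToFront_injective pre.length q.length) A.code
    fun k => (q ++ (pre ++ (suf ++ List.ofFn s))).getD k false) A.out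
  simp only [Distinguisher.accepts, runNand, Distinguisher.hardwire, List.ofFn_zero,
    List.append_nil, List.foldl_append, foldl_exec_constGates]
  refine h.trans ?_
  have hinit : (fun k => (q ++ (pre ++ (suf ++ List.ofFn s))).getD k false) ∘
      moveToFront pre.length q.length = fun k => (pre ++ q ++ suf ++ List.ofFn s).getD k false := by
    funext k
    simp only [Function.comp_apply, getD_moveToFront, List.append_assoc]
  rw [hinit]

/-! ### Averaging -/

open scoped BigOperators in
theorem uniformProb_eq_expect {Ω : Type} [Fintype Ω] (f : Ω → Bool) :
    uniformProb f = 𝔼 ω, if f ω = true then (1 : ℝ) else 0 := by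
  rw [Fintype.expect_eq_sum_div_card, Finset.sum_boole, uniformProb]

theorem uniformProb_prod_unique {Ω U : Type} [Fintype Ω] [Fintype U] [Unique U]
    (f : Ω × U → Bool) : uniformProb f = uniformProb fun ω => f (ω, default) := by
  rw [uniformProb_eq_expect, uniformProb_eq_expect]
  refine Fintype.expect_equiv (Equiv.prodUnique Ω U) _ _ ?_
  rintro ⟨ω, u⟩
  rw [Subsingleton.elim u default]
  rfl

/-- If `e` permutes `Ω × R`, then the first component of `e (ω, a)` is uniform in `Ω` for uniform
`ω` and `a`; so the difference of two probabilities is an average over `ω` of differences of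
probabilities over `a`, and some `ω` does at least as well as the average. -/
theorem exists_abs_uniformProb_sub_le {Ω R : Type} [Fintype Ω] [Fintype R] [Nonempty Ω]
    [Nonempty R] (e : Ω × R ≃ Ω × R) (F G : Ω → Bool) :
    ∃ ω, |uniformProb F - uniformProb G| ≤
      |uniformProb (fun a => F (e (ω, a)).1) - uniformProb (fun a => G (e (ω, a)).1)| := by
  have key : ∀ F : Ω → Bool,
      uniformProb F = Finset.expect Finset.univ fun ω => uniformProb fun a => F (e (ω, a)).1 := by
    intro F
    simp only [uniformProb_eq_expect]
    rw [← Finset.expect_product' Finset.univ Finset.univ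
      (fun ω a => if F (e (ω, a)).1 = true then (1 : ℝ) else 0), Finset.univ_product_univ,
      Fintype.expect_equiv e _ (fun t => if F t.1 = true then (1 : ℝ) else 0) fun _ => rfl,
      ← Finset.univ_product_univ, Finset.expect_product]
    exact Finset.expect_congr rfl fun ω _ => (Fintype.expect_const _).symm
  obtain ⟨ω, -, hω⟩ := Finset.exists_le_of_le_expect Finset.univ_nonempty
    (Finset.abs_expect_le Finset.univ fun ω =>
      uniformProb (fun a => F (e (ω, a)).1) - uniformProb (fun a => G (e (ω, a)).1))
  refine ⟨ω, ?_⟩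
  rwa [Finset.expect_sub_distrib, ← key, ← key] at hω

/-- Exchanges the `i`-th coordinate of a family with a separate value; an involution. It separates
the coins of one query from all the others, which the component `U` may extend. -/
def swapCoord {ι : Type} [DecidableEq ι] {R : ι → Type} (U : Type) (i : ι) :
    ((∀ i, R i) × U) × R i ≃ ((∀ i, R i) × U) × R i where
  toFun t := ((Function.update t.1.1 i t.2, t.1.2), t.1.1 i)
  invFun t := ((Function.update t.1.1 i t.2, t.1.2), t.1.1 i)
  left_inv := by rintro ⟨⟨r, u⟩, a⟩; simp
  right_inv := by rintro ⟨⟨r, u⟩, a⟩; simp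

/-! ### The hybrid argument -/

section Hybrid

variable {n : ℕ} {R : Fin n → Type}

/-- The `k`-th hybrid of two families of strings: the first `k` strings come from `g`, the others
from `f`. -/
def hybrid (f g : ∀ i, R i → List Bool) (k : ℕ) (r : ∀ i, R i) : List (List Bool) :=
  List.ofFn fun i : Fin n => if (i : ℕ) < k then g i (r i) else f i (r i)

theorem hybrid_update (f g : ∀ i, R i → List Bool) (r : ∀ i, R i) (i : Fin n) (a : R i) :
    hybrid f g i (Function.update r i a) = (hybrid f g i r).set i (f i a) := by
  refine List.ext_getElem (by simp [hybrid]) fun m h₁ h₂ => ?_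
  have hm : m < n := by simpa [hybrid] using h₁
  simp only [hybrid, List.getElem_ofFn, List.getElem_set]
  by_cases him : (i : ℕ) = m
  · subst him
    simp
  · have : (⟨m, hm⟩ : Fin n) ≠ i := fun h => him (by rw [← h])
    simp [him, Function.update_of_ne this]

theorem hybrid_succ_update (f g : ∀ i, R i → List Bool) (r : ∀ i, R i) (i : Fin n) (a : R i) :
    hybrid f g (i + 1) (Function.update r i a) = (hybrid f g i r).set i (g i a) := by
  refine List.ext_getElem (by simp [hybrid]) fun m h₁ h₂ => ?_
  have hm : m < n := by simpa [hybrid] using h₁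
  simp only [hybrid, List.getElem_ofFn, List.getElem_set]
  by_cases him : (i : ℕ) = m
  · subst him
    simp
  · have : (⟨m, hm⟩ : Fin n) ≠ i := fun h => him (by rw [← h])
    have hlt : m < (i : ℕ) + 1 ↔ m < (i : ℕ) := by omega
    simp [him, Function.update_of_ne this, hlt]

theorem flatten_set {α : Type} (l : List (List α)) {i : ℕ} (hi : i < l.length) (x : List α) :
    (l.set i x).flatten = (l.take i).flatten ++ x ++ (l.drop (i + 1)).flatten := by
  rw [List.set_eq_take_append_cons_drop, if_pos hi]
  simp

theorem length_flatten_take_add_drop_le {α : Type} (l : List (List α)) (i L : ℕ)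
    (hL : ∀ x ∈ l, x.length ≤ L) :
    (l.take i).flatten.length + (l.drop (i + 1)).flatten.length ≤ l.length * L := by
  have hsum : ∀ l : List (List α), (∀ x ∈ l, x.length ≤ L) → l.flatten.length ≤ l.length * L := by
    intro l hl
    rw [List.length_flatten]
    simpa using List.sum_le_card_nsmul (l.map List.length) L (by simpa using hl)
  have h₁ := hsum (l.take i) fun x hx => hL x (List.mem_of_mem_take hx)
  have h₂ := hsum (l.drop (i + 1)) fun x hx => hL x (List.mem_of_mem_drop hx)
  have hlen : (l.take i).length + (l.drop (i + 1)).length ≤ l.length := by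
    simp only [List.length_take, List.length_drop]
    omega
  calc _ ≤ (l.take i).length * L + (l.drop (i + 1)).length * L := add_le_add h₁ h₂
    _ = ((l.take i).length + (l.drop (i + 1)).length) * L := (add_mul _ _ _).symm
    _ ≤ _ := Nat.mul_le_mul_right _ hlen

variable [∀ i, Fintype (R i)] [∀ i, Nonempty (R i)]

/-- Consecutive hybrids differ in one string only. Fixing the coins of all other strings, and those
of `A`, to the most favorable values and wiring the result into the circuit turns `A` into a
distinguisher for this single string. -/
theorem exists_hybrid_step (f g : ∀ i, R i → List Bool) (len : Fin n → ℕ) (L : ℕ)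
    (hf : ∀ i r, (f i r).length = len i) (hg : ∀ i r, (g i r).length = len i)
    (hL : ∀ i, len i ≤ L) (A : Distinguisher) (i : Fin n) :
    ∃ B : Distinguisher, B.size ≤ A.size + n * L ∧
      advantage A (fun r => (hybrid f g i r).flatten) (fun r => (hybrid f g (i + 1) r).flatten) ≤
        advantage B (f i) (g i) := by
  obtain ⟨⟨r, s⟩, hrs⟩ := exists_abs_uniformProb_sub_le
    (swapCoord (R := R) (Fin A.coins → Bool) i)
    (fun t => A.accepts (hybrid f g i t.1).flatten t.2)
    (fun t => A.accepts (hybrid f g (i + 1) t.1).flatten t.2)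
  set l := hybrid f g i r with hl
  have hlen : l.length = n := by simp [hl, hybrid]
  have hi : (i : ℕ) < l.length := by omega
  have hl_le : ∀ x ∈ l, x.length ≤ L := by
    intro x hx
    obtain ⟨k, rfl⟩ := (List.mem_ofFn' _ _).1 hx
    dsimp only
    split_ifs
    · exact (hg k _).trans_le (hL k)
    · exact (hf k _).trans_le (hL k)
  refine ⟨A.hardwire (l.take i).flatten ((l.drop (i + 1)).flatten ++ List.ofFn s) (len i), ?_, ?_⟩
  · have h₁ := A.size_hardwire_le (l.take i).flatten ((l.drop (i + 1)).flatten ++ List.ofFn s)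
      (len i)
    have h₂ := length_flatten_take_add_drop_le l i L hl_le
    rw [hlen] at h₂
    rw [List.length_append, List.length_ofFn] at h₁
    have h₃ : A.size = A.code.length + A.coins := rfl
    omega
  · have hacc : ∀ (q : List Bool) (t : Fin 0 → Bool), q.length = len i →
        (A.hardwire (l.take i).flatten ((l.drop (i + 1)).flatten ++ List.ofFn s)
          (len i)).accepts q t = A.accepts (l.set i q).flatten s := by
      intro q t hq
      rw [← hq, A.hardwire_accepts, flatten_set l hi]
    have hprob : ∀ q : R i → List Bool, (∀ a, (q a).length = len i) →
        uniformProb (fun t : R i × (Fin 0 → Bool) =>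
          (A.hardwire (l.take i).flatten ((l.drop (i + 1)).flatten ++ List.ofFn s)
            (len i)).accepts (q t.1) t.2) =
        uniformProb fun a => A.accepts (l.set i (q a)).flatten s := by
      intro q hq
      rw [uniformProb_prod_unique]
      exact congrArg uniformProb (funext fun a => hacc (q a) _ (hq a))
    refine hrs.trans_eq ?_
    refine (congrArg abs (congrArg₂ (· - ·) ?_ ?_))
    · refine Eq.trans ?_ (hprob (f i) (hf i)).symm
      exact congrArg uniformProb (funext fun a => by
        simp only [swapCoord, Equiv.coe_fn_mk, hybrid_update, hl])
    · refine Eq.trans ?_ (hprob (g i) (hg i)).symm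
      exact congrArg uniformProb (funext fun a => by
        simp only [swapCoord, Equiv.coe_fn_mk, hybrid_succ_update, hl])

/-- The hybrid argument: the advantage against independent strings is at most the sum of the
advantages of suitable distinguishers against the single strings. -/
theorem exists_advantage_flatten_le_sum (f g : ∀ i, R i → List Bool) (len : Fin n → ℕ) (L : ℕ)
    (hf : ∀ i r, (f i r).length = len i) (hg : ∀ i r, (g i r).length = len i)
    (hL : ∀ i, len i ≤ L) (A : Distinguisher) :
    ∃ B : Fin n → Distinguisher, (∀ i, (B i).size ≤ A.size + n * L) ∧
      advantage A (fun r : ∀ i, R i => (List.ofFn fun i => f i (r i)).flatten)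
        (fun r => (List.ofFn fun i => g i (r i)).flatten) ≤
      ∑ i, advantage (B i) (f i) (g i) := by
  choose B hB hadv using exists_hybrid_step f g len L hf hg hL A
  refine ⟨B, hB, le_trans ?_ (Finset.sum_le_sum fun i _ => hadv i)⟩
  have h0 : (fun r : ∀ i, R i => (List.ofFn fun i => f i (r i)).flatten) =
      fun r => (hybrid f g 0 r).flatten := by
    simp [hybrid]
  have hn : (fun r : ∀ i, R i => (List.ofFn fun i => g i (r i)).flatten) =
      fun r => (hybrid f g n r).flatten := by
    simp [hybrid]
  rw [h0, hn, Fin.sum_univ_eq_sum_range fun k => advantage A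
    (fun r => (hybrid f g k r).flatten) (fun r => (hybrid f g (k + 1) r).flatten)]
  exact dist_le_range_sum_dist (fun k => uniformProb fun t : (∀ i, R i) × (Fin A.coins → Bool) =>
    A.accepts (hybrid f g k t.1).flatten t.2) n

end Hybrid

/-! ### Polynomial bounds and negligible functions -/

theorem exists_eval_le_pow (p : Polynomial ℕ) :
    ∃ d κ₀ : ℕ, ∀ κ > κ₀, p.eval κ ≤ κ ^ d := by
  -- `p.eval 1` is the sum of the coefficients of `p`.
  refine ⟨p.natDegree + 1, p.eval 1, fun κ hκ => ?_⟩
  have hκ1 : 1 ≤ κ := by omega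
  calc p.eval κ ≤ p.eval 1 * κ ^ p.natDegree := by
        rw [Polynomial.eval_eq_sum_range, Polynomial.eval_eq_sum_range, Finset.sum_mul]
        refine Finset.sum_le_sum fun i hi => ?_
        rw [one_pow, mul_one]
        exact Nat.mul_le_mul_left _ (Nat.pow_le_pow_right hκ1
          (Nat.lt_succ_iff.1 (Finset.mem_range.1 hi)))
    _ ≤ κ * κ ^ p.natDegree := Nat.mul_le_mul_right _ hκ.le
    _ = κ ^ (p.natDegree + 1) := (pow_succ' _ _).symm

theorem Negligible.mono {ε δ : ℕ → ℝ} (hε : Negligible ε) (h : ∀ κ, δ κ ≤ ε κ) :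
    Negligible δ := fun c hc =>
  let ⟨κ₀, hκ₀⟩ := hε c hc
  ⟨κ₀, fun κ hκ => (h κ).trans_lt (hκ₀ κ hκ)⟩

theorem Negligible.polyBounded_mul {ε : ℕ → ℝ} (hε : Negligible ε) {f : ℕ → ℕ}
    (hf : PolyBounded f) (hf0 : ∀ κ, 1 ≤ f κ) : Negligible fun κ => f κ * ε κ := by
  obtain ⟨p, hp⟩ := hf
  obtain ⟨d, κ₁, hd⟩ := exists_eval_le_pow p
  intro c hc
  obtain ⟨κ₀, hκ₀⟩ := hε (c + d) (by omega)
  refine ⟨max κ₀ κ₁, fun κ hκ => ?_⟩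
  have hκpos : (0 : ℝ) < κ := by exact_mod_cast (by omega : 0 < κ)
  have hfpos : (0 : ℝ) < f κ := by exact_mod_cast hf0 κ
  have hfle : (f κ : ℝ) ≤ (κ : ℝ) ^ d := by
    exact_mod_cast (hp κ).trans (hd κ (lt_of_le_of_lt (le_max_right _ _) hκ))
  calc (f κ : ℝ) * ε κ < f κ * (1 / (κ : ℝ) ^ (c + d)) :=
        mul_lt_mul_of_pos_left (hκ₀ κ (lt_of_le_of_lt (le_max_left _ _) hκ)) hfpos
    _ ≤ (κ : ℝ) ^ d * (1 / (κ : ℝ) ^ (c + d)) :=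
        mul_le_mul_of_nonneg_right hfle (by positivity)
    _ = 1 / (κ : ℝ) ^ c := by
        rw [pow_add]
        field_simp

/-- A sum of polynomially many terms is negligible if the largest term of each sum is. -/
theorem Negligible.sum {h : ℕ → ℕ} (hpos : ∀ κ, 1 ≤ h κ) (hpoly : PolyBounded h)
    {ε : ∀ κ, Fin (h κ) → ℝ} (hε : ∀ i : (∀ κ, Fin (h κ)), Negligible fun κ => ε κ (i κ)) :
    Negligible fun κ => ∑ i, ε κ i := by
  have hmax : ∀ κ, ∃ i : Fin (h κ), ∀ k, ε κ k ≤ ε κ i := fun κ =>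
    have : Nonempty (Fin (h κ)) := ⟨⟨0, hpos κ⟩⟩
    Finite.exists_max (ε κ)
  choose i hi using hmax
  refine ((hε i).polyBounded_mul hpoly hpos).mono fun κ => ?_
  simpa using Finset.sum_le_card_nsmul Finset.univ (ε κ) (ε κ (i κ)) fun k _ => hi κ k

/-! ### Query lengths and batch queries -/

/-- Query lengths are polynomially bounded, because each bit of a query is an output of the circuit
that generates it. Databases without items are excluded: they have no index, so there `PPTQuery`
says nothing about the outputs of the circuit. -/
theorem PIRScheme.PPTQuery.exists_queryLen_le {itemLen : ℕ → ℕ} {S : PIRScheme itemLen}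
    {D : ℕ → ℕ} (hS : S.PPTQuery D) :
    ∃ p : Polynomial ℕ, ∀ κ n, n ≤ D κ → 0 < n → S.queryLen κ n ≤ p.eval κ := by
  obtain ⟨p, hp⟩ := hS
  refine ⟨p, fun κ n hn hn0 => ?_⟩
  obtain ⟨-, P, hsize, hP⟩ := hp κ n hn
  have hlen := congrArg List.length (hP ⟨0, hn0⟩ fun _ => false)
  rw [NandProgram.eval, List.length_map, List.length_ofFn] at hlen
  unfold NandProgram.size at hsize
  omega

theorem card_node (h : ℕ) : Fintype.card (Node h) = treeSize h := by
  rw [Fintype.card_coe, Nat.card_Ico, treeSize]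

theorem sum_classSize {h : ℕ} (color : Node h → Fin h) :
    ∑ i, classSize color i = treeSize h := by
  rw [← card_node, ← Fintype.card_sigma]
  exact Fintype.card_congr (Equiv.sigmaFiberEquiv color)

theorem classSize_le_treeSize {h : ℕ} (color : Node h → Fin h) (i : Fin h) :
    classSize color i ≤ treeSize h := by
  rw [← sum_classSize color]
  exact Finset.single_le_sum (f := classSize color) (fun _ _ => Nat.zero_le _) (Finset.mem_univ i)

theorem exists_batchAdvantage_le_sum {itemLen : ℕ → ℕ} (S : PIRScheme itemLen) (κ : ℕ) {h : ℕ}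
    (P : AncestralPartition h) (j j' : Leaf h) (L : ℕ) (hL : ∀ i, S.queryLen κ (P.size i) ≤ L)
    (A : Distinguisher) :
    ∃ B : Fin h → Distinguisher, (∀ i, (B i).size ≤ A.size + h * L) ∧
      batchAdvantage S κ P j j' A ≤
        ∑ i, S.queryAdvantage κ (P.size i) (P.subIndex j i) (P.subIndex j' i) (B i) :=
  exists_advantage_flatten_le_sum
    (fun i r => List.ofFn (S.query κ (P.size i) (P.subIndex j i) r))
    (fun i r => List.ofFn (S.query κ (P.size i) (P.subIndex j' i) r))
    (fun i => S.queryLen κ (P.size i)) L (fun _ _ => List.length_ofFn)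
    (fun _ _ => List.length_ofFn) hL A

/-- The hybrid argument for all `κ` at once: one polynomial in `κ` bounds the sizes of all the
distinguishers for single queries. -/
theorem exists_family_batchAdvantage_le_sum {itemLen : ℕ → ℕ} {S : PIRScheme itemLen} {h : ℕ → ℕ}
    (hpoly : PolyBounded h) (hquery : S.PPTQuery fun κ => treeSize (h κ))
    (P : ∀ κ, AncestralPartition (h κ)) (j j' : ∀ κ, Leaf (h κ)) {A : ℕ → Distinguisher}
    (hA : IsPPT A) :
    ∃ B : (∀ κ, Fin (h κ) → Distinguisher),
      (∃ p : Polynomial ℕ, ∀ κ i, (B κ i).size ≤ p.eval κ) ∧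
      ∀ κ, batchAdvantage S κ (P κ) (j κ) (j' κ) (A κ) ≤
        ∑ i, S.queryAdvantage κ ((P κ).size i) ((P κ).subIndex (j κ) i)
          ((P κ).subIndex (j' κ) i) (B κ i) := by
  obtain ⟨pA, hpA⟩ := hA
  obtain ⟨ph, hph⟩ := hpoly
  obtain ⟨pq, hpq⟩ := hquery.exists_queryLen_le
  choose B hB hadv using fun κ => exists_batchAdvantage_le_sum S κ (P κ) (j κ) (j' κ) (pq.eval κ)
    (fun i => hpq κ _ (classSize_le_treeSize _ i) ((P κ).subIndex (j κ) i).pos) (A κ)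
  refine ⟨B, ⟨pA + ph * pq, fun κ i => ?_⟩, hadv⟩
  rw [Polynomial.eval_add, Polynomial.eval_mul]
  exact (hB κ i).trans (add_le_add (hpA κ) (Nat.mul_le_mul_right _ (hph κ)))

theorem PIRScheme.Private.negligible_queryAdvantage {itemLen : ℕ → ℕ} {S : PIRScheme itemLen}
    {h : ℕ → ℕ} (hS : S.Private fun κ => treeSize (h κ)) (P : ∀ κ, AncestralPartition (h κ))
    (j j' : ∀ κ, Leaf (h κ)) {B : ∀ κ, Fin (h κ) → Distinguisher}
    (hB : ∃ p : Polynomial ℕ, ∀ κ i, (B κ i).size ≤ p.eval κ) (i : ∀ κ, Fin (h κ)) :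
    Negligible fun κ => S.queryAdvantage κ ((P κ).size (i κ)) ((P κ).subIndex (j κ) (i κ))
      ((P κ).subIndex (j' κ) (i κ)) (B κ (i κ)) :=
  hS (fun κ => (P κ).size (i κ)) (fun _ => classSize_le_treeSize _ _) _ _ _
    (let ⟨p, hp⟩ := hB; ⟨p, fun κ => hp κ (i κ)⟩)

/-! ### Sizes of balanced color classes -/

section Sizes

variable {h : ℕ} {color : Node h → Fin h}

theorem IsBalanced.treeSize_lt (hb : IsBalanced color) (i : Fin h) :
    treeSize h < h * (classSize color i + 1) := by
  rw [← sum_classSize color]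
  calc ∑ k, classSize color k < ∑ _k : Fin h, (classSize color i + 1) :=
        Finset.sum_lt_sum (fun k _ => hb k i) ⟨i, Finset.mem_univ i, Nat.lt_succ_self _⟩
    _ = h * (classSize color i + 1) := by simp

theorem IsBalanced.mul_classSize_lt (hb : IsBalanced color) (i : Fin h) :
    h * classSize color i < treeSize h + h := by
  rw [← sum_classSize color]
  calc h * classSize color i = ∑ _k : Fin h, classSize color i := by simp
    _ < ∑ k, (classSize color k + 1) :=
        Finset.sum_lt_sum (fun k _ => hb i k) ⟨i, Finset.mem_univ i, Nat.lt_succ_self _⟩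
    _ = _ := by simp [Finset.sum_add_distrib]

theorem IsBalanced.classSize_eq (hb : IsBalanced color) (i : Fin h) :
    classSize color i = ⌊(treeSize h : ℚ) / (h : ℚ)⌋₊ ∨
      classSize color i = ⌈(treeSize h : ℚ) / (h : ℚ)⌉₊ := by
  have hh : (0 : ℚ) < h := by exact_mod_cast i.pos
  have h₁ : (treeSize h : ℚ) < h * (classSize color i + 1) := by exact_mod_cast hb.treeSize_lt i
  have h₂ : (h * classSize color i : ℚ) < treeSize h + h := by
    exact_mod_cast hb.mul_classSize_lt i
  rcases le_total ((classSize color i : ℚ)) ((treeSize h : ℚ) / h) with hle | hle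
  · left
    rw [eq_comm, Nat.floor_eq_iff (by positivity)]
    refine ⟨hle, ?_⟩
    rw [div_lt_iff₀ hh]
    linarith
  · right
    refine le_antisymm ?_ (Nat.ceil_le.2 hle)
    refine Nat.lt_succ_iff.1 (?_ : _ < _)
    have : (classSize color i : ℚ) < ⌈(treeSize h : ℚ) / (h : ℚ)⌉₊ + 1 := by
      have h₃ : (treeSize h : ℚ) / h > classSize color i - 1 := by
        rw [gt_iff_lt, lt_div_iff₀ hh]
        linarith
      linarith [Nat.le_ceil ((treeSize h : ℚ) / h)]
    exact_mod_cast this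

theorem IsBalanced.classSize_le_ceil (hb : IsBalanced color) (i : Fin h) :
    classSize color i ≤ ⌈(treeSize h : ℚ) / (h : ℚ)⌉₊ := by
  rcases hb.classSize_eq i with hi | hi
  · exact hi.trans_le (Nat.floor_le_ceil _)
  · exact hi.le

/-- Some class attains the average size `N / h`, hence also its ceiling. -/
theorem IsBalanced.exists_classSize_eq_ceil (hb : IsBalanced color) (hpos : 1 ≤ h) :
    ∃ i, classSize color i = ⌈(treeSize h : ℚ) / (h : ℚ)⌉₊ := by
  have : Nonempty (Fin h) := ⟨⟨0, hpos⟩⟩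
  have hh : (0 : ℚ) < h := by exact_mod_cast hpos
  obtain ⟨i, hi⟩ := Finite.exists_max (classSize color)
  refine ⟨i, le_antisymm (hb.classSize_le_ceil i) (Nat.ceil_le.2 ?_)⟩
  have hsum : treeSize h ≤ h * classSize color i := by
    rw [← sum_classSize color]
    simpa using Finset.sum_le_card_nsmul Finset.univ (classSize color) _ fun k _ => hi k
  rw [div_le_iff₀ hh]
  exact_mod_cast hsum.trans_eq (mul_comm _ _)

end Sizes

/-! ### Parallel server time -/

theorem sibling_sibling {h : ℕ} (v : Node h) : sibling (sibling v) = v := by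
  have hv := Finset.mem_Ico.1 v.2
  apply Subtype.ext
  unfold sibling
  dsimp only
  split_ifs <;> omega

theorem exists_pathNode_eq {h : ℕ} (v : Node h) : ∃ (j : Leaf h) (k : Fin h), pathNode j k = v := by
  obtain ⟨v, hv⟩ := v
  have hv' := Finset.mem_Ico.1 hv
  have hlow : 2 ^ Nat.log 2 v ≤ v := Nat.pow_log_le_self 2 (by omega)
  have hhigh : v < 2 ^ (Nat.log 2 v + 1) := Nat.lt_pow_succ_log_self (by norm_num) v
  have hlog : Nat.log 2 v ≤ h := Nat.lt_succ_iff.1 (Nat.log_lt_of_lt_pow (by omega) hv'.2)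
  have hlog1 : 1 ≤ Nat.log 2 v := (Nat.le_log_iff_pow_le (by norm_num) (by omega)).2 (by omega)
  -- The witness is the leftmost leaf below `v`, a node of depth `Nat.log 2 v`.
  refine ⟨⟨v * 2 ^ (h - Nat.log 2 v), Finset.mem_Ico.2 ⟨?_, ?_⟩⟩, ⟨h - Nat.log 2 v, by omega⟩,
    Subtype.ext (Nat.mul_div_cancel _ (by positivity))⟩
  · calc 2 ^ h = 2 ^ Nat.log 2 v * 2 ^ (h - Nat.log 2 v) := by
          rw [← pow_add]
          congr 1
          omega
      _ ≤ _ := Nat.mul_le_mul_right _ hlow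
  · calc v * 2 ^ (h - Nat.log 2 v) < 2 ^ (Nat.log 2 v + 1) * 2 ^ (h - Nat.log 2 v) :=
          Nat.mul_lt_mul_of_pos_right hhigh (by positivity)
      _ = 2 ^ (h + 1) := by
          rw [← pow_add]
          congr 1
          omega

namespace AncestralPartition

variable {h : ℕ} (P : AncestralPartition h)

theorem exists_subIndex_eq (i : Fin h) (k : Fin (P.size i)) : ∃ j, P.subIndex j i = k := by
  obtain ⟨⟨v, hv⟩, rfl⟩ := (P.enum i).surjective k
  obtain ⟨j, l, rfl⟩ := exists_pathNode_eq v
  refine ⟨j, congrArg (P.enum i) (Subtype.ext ?_)⟩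
  -- A path has only one node of color `i`.
  exact congrArg (pathNode j) (pathNode_color_injective P.ancestral j
    ((exists_pathNode_color P.ancestral j i).choose_spec.trans hv.symm))

theorem exists_subDatabase_eq {α : Type} [Nonempty α] (i : Fin h) (y : Fin (P.size i) → α) :
    ∃ x, P.subDatabase x i = y := by
  have hinj : Function.Injective fun k : Fin (P.size i) =>
      sibling ((P.enum i).symm k : ColorClass P.color i).1 := fun k l hkl =>
    (P.enum i).symm.injective (Subtype.ext
      (Function.LeftInverse.injective sibling_sibling hkl))
  exact ⟨Function.extend _ y fun _ => Classical.arbitrary α, funext fun k =>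
    hinj.extend_apply y _ k⟩

end AncestralPartition

section ServerTime

variable {itemLen : ℕ → ℕ} (S : PIRScheme itemLen) (κ : ℕ) {h : ℕ} (P : AncestralPartition h)

theorem parallelServerTime_le {T : ℕ} (hT : ∀ i, S.serverTime κ (P.size i) ≤ T) :
    parallelServerTime S κ P ≤ T :=
  Finset.sup_le fun t _ => Finset.sup_le fun i _ => le_trans
    (Finset.le_sup
      (f := fun u : (Fin (P.size i) → Item itemLen κ) × Fin (P.size i) ×
        (Fin (S.coins κ (P.size i)) → Bool) => S.serverSteps κ (P.size i) u.1 u.2.1 u.2.2)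
      (Finset.mem_univ (P.subDatabase t.1 i, P.subIndex t.2.1 i, t.2.2 i))) (hT i)

/-- Every run of server `i` occurs in an execution of the parallel retrieval, since every index
and every content of its sub-database do. -/
theorem serverTime_le_parallelServerTime (i : Fin h) :
    S.serverTime κ (P.size i) ≤ parallelServerTime S κ P := by
  refine Finset.sup_le ?_
  rintro ⟨y, k, r⟩ -
  obtain ⟨x, rfl⟩ := P.exists_subDatabase_eq i y
  obtain ⟨j, rfl⟩ := P.exists_subIndex_eq i k
  have h₁ := Finset.le_sup (f := fun i' : Fin h => S.serverSteps κ (P.size i')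
    (P.subDatabase x i') (P.subIndex j i')
    (Function.update (fun _ _ => false : BatchCoins S κ P) i r i')) (Finset.mem_univ i)
  rw [Function.update_self] at h₁
  exact h₁.trans (Finset.le_sup
    (f := fun t : (Node h → Item itemLen κ) × Leaf h × BatchCoins S κ P =>
      parallelSteps S κ P t.1 t.2.1 t.2.2)
    (Finset.mem_univ (x, j, Function.update (fun _ _ => false : BatchCoins S κ P) i r)))

end ServerTime

end MerklePIR

theorem mainTheorem6 {itemLen : ℕ → ℕ} (S : MerklePIR.PIRScheme itemLen)
    (h : ℕ → ℕ) (hpos : ∀ κ, 1 ≤ h κ) (hpoly : MerklePIR.PolyBounded h)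
    (hquery : S.PPTQuery fun κ => MerklePIR.treeSize (h κ))
    (hprivate : S.Private fun κ => MerklePIR.treeSize (h κ))
    (C : ℕ → ℕ → ℕ) (hmono : ∀ κ, Monotone (C κ))
    (htime : ∀ κ d, S.serverTime κ d ≤ C κ d) :
    -- privacy, for every choice of ancestral colorings
    (∀ P : (∀ κ, MerklePIR.AncestralPartition (h κ)),
      MerklePIR.BatchPrivate S P ∧
      -- the advantage is at most a sum of `h` advantages against the underlying scheme
      ∀ (j j' : ∀ κ, MerklePIR.Leaf (h κ)) (A : ℕ → MerklePIR.Distinguisher),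
        MerklePIR.IsPPT A →
        ∃ B : (∀ κ, Fin (h κ) → MerklePIR.Distinguisher),
          (∃ p : Polynomial ℕ, ∀ κ i, (B κ i).size ≤ p.eval κ) ∧
          (∀ κ, MerklePIR.batchAdvantage S κ (P κ) (j κ) (j' κ) (A κ) ≤
            ∑ i, S.queryAdvantage κ ((P κ).size i) ((P κ).subIndex (j κ) i)
              ((P κ).subIndex (j' κ) i) (B κ i)) ∧
          (∀ i : (∀ κ, Fin (h κ)), MerklePIR.Negligible fun κ =>
            S.queryAdvantage κ ((P κ).size (i κ)) ((P κ).subIndex (j κ) (i κ))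
              ((P κ).subIndex (j' κ) (i κ)) (B κ (i κ))) ∧
          MerklePIR.Negligible fun κ =>
            ∑ i, S.queryAdvantage κ ((P κ).size i) ((P κ).subIndex (j κ) i)
              ((P κ).subIndex (j' κ) i) (B κ i)) ∧
    -- sizes and parallel server time, for balanced ancestral colorings
    (∀ (κ : ℕ) (P : MerklePIR.AncestralPartition (h κ)), MerklePIR.IsBalanced P.color →
      (∀ i, P.size i = ⌊(MerklePIR.treeSize (h κ) : ℚ) / (h κ : ℚ)⌋₊ ∨
        P.size i = ⌈(MerklePIR.treeSize (h κ) : ℚ) / (h κ : ℚ)⌉₊) ∧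
      MerklePIR.parallelServerTime S κ P ≤
        C κ ⌈(MerklePIR.treeSize (h κ) : ℚ) / (h κ : ℚ)⌉₊ ∧
      (S.serverTime κ ⌈(MerklePIR.treeSize (h κ) : ℚ) / (h κ : ℚ)⌉₊ =
          C κ ⌈(MerklePIR.treeSize (h κ) : ℚ) / (h κ : ℚ)⌉₊ →
        MerklePIR.parallelServerTime S κ P =
          C κ ⌈(MerklePIR.treeSize (h κ) : ℚ) / (h κ : ℚ)⌉₊)) := by
  refine ⟨fun P => ?_, fun κ P hb => ⟨hb.classSize_eq, ?_, fun hC => ?_⟩⟩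
  · refine ⟨fun j j' A hA => ?_, fun j j' A hA => ?_⟩
    · obtain ⟨B, hB, hadv⟩ :=
        MerklePIR.exists_family_batchAdvantage_le_sum hpoly hquery P j j' hA
      exact (MerklePIR.Negligible.sum hpos hpoly
        (hprivate.negligible_queryAdvantage P j j' hB)).mono hadv
    · obtain ⟨B, hB, hadv⟩ :=
        MerklePIR.exists_family_batchAdvantage_le_sum hpoly hquery P j j' hA
      have hneg := hprivate.negligible_queryAdvantage P j j' hB
      exact ⟨B, hB, hadv, hneg, MerklePIR.Negligible.sum hpos hpoly hneg⟩
  · exact MerklePIR.parallelServerTime_le S κ P fun i =>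
      (htime κ _).trans (hmono κ (hb.classSize_le_ceil i))
  · obtain ⟨i, hi⟩ := hb.exists_classSize_eq_ceil (hpos κ)
    refine le_antisymm (MerklePIR.parallelServerTime_le S κ P fun i =>
      (htime κ _).trans (hmono κ (hb.classSize_le_ceil i))) ?_
    rw [← hC, ← hi]
    exact MerklePIR.serverTime_le_parallelServerTime S κ P i
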